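/- Let $T$ be a primitive recursively axiomatized consistent extension of Peano Arithmetic $\mathsf{PA}$ in the language of first-order arithmetic, and suppose that $T$ is $\Sigma_1$-sound, i.e. every $\Sigma_1$ sentence provable in $T$ is true in the standard model $\mathbb{N}$. Here $\Delta_0$ is the set of formulas all of whose quantifiers are bounded, and $\Sigma_1$, $\Pi_1$ are the smallest classes of formulas that contain $\Delta_0$, are closed under $\wedge$, $\vee$ and under $\exists$ (for $\Sigma_1$), respectively $\forall$ (for $\Pi_1$), and are such that $\neg\varphi$ is $\Pi_1$ (resp. $\Sigma_1$) whenever $\varphi$ is $\Sigma_1$ (resp. $\Pi_1$), and $\varphi\to\psi$ is $\Pi_1$ (resp. $\Sigma_1$) whenever $\varphi$ is $\Sigma_1$ (resp. $\Pi_1$) and $\psi$ is $\Pi_1$ (resp. $\Sigma_1$). Fix a natural Gödel numbering, and let $\ulcorner\varphi\urcorner$ be the numeral of the Gödel number of $\varphi$. A formula $\mathrm{PR}(x)$ is a provability predicate of $T$ if for every formula $\varphi$: $T\vdash\varphi$ if and only if $\mathsf{PA}\vdash\mathrm{PR}(\ulcorner\varphi\urcorner)$. An arithmetical interpretation based on $\mathrm{PR}$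 is a map $f$ from the formulas of propositional modal logic (with $\bot,\neg,\wedge,\vee,\to,\Box$) to sentences of arithmetic such that $f(\bot)$ is $0=1$, $f$ commutes with $\neg,\wedge,\vee,\to$, and $f(\Box A)$ is $\mathrm{PR}(\ulcorner f(A)\urcorner)$. The provability logic $\mathrm{PL}(\mathrm{PR})$ is the set of all modal formulas $A$ such that $T\vdash f(A)$ for every arithmetical interpretation $f$ based on $\mathrm{PR}$. Put $\Box^0A=A$ and $\Box^{k+1}A=\Box\Box^kA$. Let $m\ge 1$. Then: 1. For every propositional variable $p$, there is no $\Sigma_1$ provability predicate $\mathrm{PR}(x)$ of $T$ such that $p\to\Box^m p\in\mathrm{PL}(\mathrm{PR})$. 2. Hence there is no $\Sigma_1$ provability predicate $\mathrm{PR}(x)$ of $T$ such that $\mathrm{PL}(\mathrm{PR})=\mathbf{N}^+\mathbf{A}_{m,0}$, where $\mathbf{N}^+\mathbf{A}_{m,0}$ is the set of modal formulas derivable from all propositional tautologies (in the modal language) and all formulas $A\to\Box^m A$ by the rules modus ponens, necessitation (from $A$ infer $\Box A$), and from $\neg\Box A$ infer $\neg\Box\Box A$. -/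

import Mathlib

namespace ProvLogic

open FirstOrder FirstOrder.Language

/-! ### The language of first-order arithmetic and its standard model -/

/-- The function symbols of arithmetic: `0`, successor, `+` and `·`. -/
inductive ArithFunc : ℕ → Type
  | zero : ArithFunc 0
  | succ : ArithFunc 1
  | add : ArithFunc 2
  | mul : ArithFunc 2

/-- The only relation symbol of arithmetic besides equality: `<`. -/
inductive ArithRel : ℕ → Type
  | lt : ArithRel 2

/-- The language `{0, S, +, ·, <}` of first-order arithmetic. -/
abbrev LA : FirstOrder.Language.{0, 0} where
  Functions := ArithFunc
  Relations := ArithRel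

/-- The standard model of arithmetic. -/
instance standardModel : LA.Structure ℕ where
  funMap {_} f v :=
    match f, v with
    | .zero, _ => 0
    | .succ, v => v 0 + 1
    | .add, v => v 0 + v 1
    | .mul, v => v 0 * v 1
  RelMap {_} r v :=
    match r, v with
    | .lt, v => v 0 < v 1

section Formulas

variable {α β : Type}

/-- The term `0`. -/
def tZero : LA.Term α := Term.func ArithFunc.zero ![]

/-- The term `S t`. -/
def tSucc (t : LA.Term α) : LA.Term α := Term.func ArithFunc.succ ![t]

/-- The term `s + t`. -/
def tAdd (s t : LA.Term α) : LA.Term α := Term.func ArithFunc.add ![s, t]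

/-- The term `s · t`. -/
def tMul (s t : LA.Term α) : LA.Term α := Term.func ArithFunc.mul ![s, t]

/-- The atomic formula `s < t`. -/
def fLt {n : ℕ} (s t : LA.Term (α ⊕ Fin n)) : LA.BoundedFormula α n :=
  BoundedFormula.rel ArithRel.lt ![s, t]

/-- The numeral of `n`, that is `S … S 0` with `n` successor symbols. -/
def numeral : ℕ → LA.Term α
  | 0 => tZero
  | n + 1 => tSucc (numeral n)

/-- The bound variable of level `i`, as a term. -/
def bvar {n : ℕ} (i : Fin n) : LA.Term (α ⊕ Fin n) := Term.var (Sum.inr i)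

/-- A term read in a context with one more bound variable (the new, last one). -/
def tLift {n : ℕ} (t : LA.Term (α ⊕ Fin n)) : LA.Term (α ⊕ Fin (n + 1)) :=
  t.relabel (Sum.map id Fin.castSucc)

/-- The extension of a substitution under a quantifier: the newly bound variable is sent to
the newly bound variable. -/
def liftSubst {n m : ℕ} (f : α ⊕ Fin n → LA.Term (β ⊕ Fin m)) :
    α ⊕ Fin (n + 1) → LA.Term (β ⊕ Fin (m + 1)) :=
  Sum.elim (fun a => tLift (f (Sum.inl a)))
    (Fin.snoc (fun i => tLift (f (Sum.inr i))) (bvar (Fin.last m)))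

/-- Capture-avoiding simultaneous substitution of terms for all variables that are not
quantified inside the formula, both the free ones and those of the ambient context. -/
def fSubst : ∀ {n m : ℕ}, (α ⊕ Fin n → LA.Term (β ⊕ Fin m)) →
    LA.BoundedFormula α n → LA.BoundedFormula β m
  | _, _, _, .falsum => .falsum
  | _, _, f, .equal s t => .equal (s.subst f) (t.subst f)
  | _, _, f, .rel R ts => .rel R fun i => (ts i).subst f
  | _, _, f, .imp φ ψ => .imp (fSubst f φ) (fSubst f ψ)
  | _, _, f, .all φ => .all (fSubst (liftSubst f) φ)

/-- `φ(t)`: the term `t` is substituted for the last variable of the context of `φ`. -/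
def inst {n : ℕ} (φ : LA.BoundedFormula α (n + 1)) (t : LA.Term (α ⊕ Fin n)) :
    LA.BoundedFormula α n :=
  fSubst (Sum.elim (fun a => Term.var (Sum.inl a)) (Fin.snoc bvar t)) φ

/-- `φ`, read in a context with one more variable, which does not occur in it. -/
def weaken {n : ℕ} (φ : LA.BoundedFormula α n) : LA.BoundedFormula α (n + 1) :=
  fSubst (fun x => tLift (Term.var x)) φ

/-- `φ(S x)`, where `x` is the last variable of the context of `φ`. -/
def instSucc {n : ℕ} (φ : LA.BoundedFormula α (n + 1)) : LA.BoundedFormula α (n + 1) :=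
  fSubst (Sum.elim (fun a => Term.var (Sum.inl a))
    (Fin.snoc (fun i => bvar i.castSucc) (tSucc (bvar (Fin.last n))))) φ

/-- A sentence, regarded as a formula in any set of free variables and any context. -/
def ofSentence {n : ℕ} (σ : LA.Sentence) : LA.BoundedFormula α n :=
  fSubst (Sum.elim Empty.elim Fin.elim0) σ

/-- For a formula `θ(x)` with at most the free variable `x`, the sentence `θ(k̄)`, where `k̄` is
the numeral of `k`. -/
def applyNumeral (θ : LA.Formula (Fin 1)) (k : ℕ) : LA.Sentence :=
  fSubst (Sum.elim (fun _ => numeral k) Fin.elim0) θ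

end Formulas

/-! ### First-order derivability -/

/-- Classical natural deduction with equality: `Derives T Γ φ` says that `φ` is derivable from
axioms in `T` and open assumptions in `Γ`. Formulas have free variables in `ℕ`, and the
eigenvariable of the introduction rule of `∀` is the last variable of the extended context, so that
it cannot occur in `Γ`. The primitive logical symbols are `⊥`, `=`, `→` and `∀`, and the others
are defined from them classically. -/
inductive Derives (T : LA.Theory) : ∀ {n : ℕ}, Set (LA.BoundedFormula ℕ n) →
    LA.BoundedFormula ℕ n → Prop
  | hyp {n : ℕ} {Γ : Set (LA.BoundedFormula ℕ n)} {φ : LA.BoundedFormula ℕ n}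
      (h : φ ∈ Γ) : Derives T Γ φ
  | ax {n : ℕ} {Γ : Set (LA.BoundedFormula ℕ n)} {σ : LA.Sentence}
      (h : σ ∈ T) : Derives T Γ (ofSentence σ)
  | impI {n : ℕ} {Γ : Set (LA.BoundedFormula ℕ n)} {φ ψ : LA.BoundedFormula ℕ n}
      (h : Derives T (insert φ Γ) ψ) : Derives T Γ (φ.imp ψ)
  | impE {n : ℕ} {Γ : Set (LA.BoundedFormula ℕ n)} {φ ψ : LA.BoundedFormula ℕ n}
      (h₁ : Derives T Γ (φ.imp ψ)) (h₂ : Derives T Γ φ) : Derives T Γ ψ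
  | raa {n : ℕ} {Γ : Set (LA.BoundedFormula ℕ n)} {φ : LA.BoundedFormula ℕ n}
      (h : Derives T (insert φ.not Γ) ⊥) : Derives T Γ φ
  | allI {n : ℕ} {Γ : Set (LA.BoundedFormula ℕ n)} {φ : LA.BoundedFormula ℕ (n + 1)}
      (h : Derives T (weaken '' Γ) φ) : Derives T Γ φ.all
  | allE {n : ℕ} {Γ : Set (LA.BoundedFormula ℕ n)} {φ : LA.BoundedFormula ℕ (n + 1)}
      (h : Derives T Γ φ.all) (t : LA.Term (ℕ ⊕ Fin n)) : Derives T Γ (inst φ t)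
  | eqRefl {n : ℕ} {Γ : Set (LA.BoundedFormula ℕ n)} (t : LA.Term (ℕ ⊕ Fin n)) :
      Derives T Γ (.equal t t)
  | eqSubst {n : ℕ} {Γ : Set (LA.BoundedFormula ℕ n)} {s t : LA.Term (ℕ ⊕ Fin n)}
      (φ : LA.BoundedFormula ℕ (n + 1))
      (h₁ : Derives T Γ (.equal s t)) (h₂ : Derives T Γ (inst φ s)) : Derives T Γ (inst φ t)

/-- `T ⊢ φ` for a formula `φ`, which may have free variables. -/
def Provable (T : LA.Theory) (φ : LA.Formula ℕ) : Prop := Derives T ∅ φ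

/-- `T ⊢ σ` for a sentence `σ`. -/
def ProvableSentence (T : LA.Theory) (σ : LA.Sentence) : Prop := Provable T (ofSentence σ)

/-- `T` is consistent. -/
def Consistent (T : LA.Theory) : Prop := ¬ ProvableSentence T ⊥

/-! ### Peano arithmetic -/

/-- The axioms of Peano arithmetic: the recursive equations for successor, `+`, `·` and `<`, and
the universal closures of all instances of the induction scheme. -/
inductive IsPAAxiom : LA.Sentence → Prop
  | succ_ne_zero : IsPAAxiom (BoundedFormula.equal (tSucc (bvar 0)) tZero :
      LA.BoundedFormula Empty 1).not.alls
  | succ_inj : IsPAAxiom ((BoundedFormula.equal (tSucc (bvar 0)) (tSucc (bvar 1)) :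
      LA.BoundedFormula Empty 2).imp (.equal (bvar 0) (bvar 1))).alls
  | add_zero : IsPAAxiom (BoundedFormula.equal (tAdd (bvar 0) tZero) (bvar 0) :
      LA.BoundedFormula Empty 1).alls
  | add_succ : IsPAAxiom (BoundedFormula.equal (tAdd (bvar 0) (tSucc (bvar 1)))
      (tSucc (tAdd (bvar 0) (bvar 1))) : LA.BoundedFormula Empty 2).alls
  | mul_zero : IsPAAxiom (BoundedFormula.equal (tMul (bvar 0) tZero) tZero :
      LA.BoundedFormula Empty 1).alls
  | mul_succ : IsPAAxiom (BoundedFormula.equal (tMul (bvar 0) (tSucc (bvar 1)))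
      (tAdd (tMul (bvar 0) (bvar 1)) (bvar 0)) : LA.BoundedFormula Empty 2).alls
  | not_lt_zero : IsPAAxiom (fLt (bvar 0) tZero : LA.BoundedFormula Empty 1).not.alls
  | lt_succ : IsPAAxiom ((fLt (bvar 0) (tSucc (bvar 1)) : LA.BoundedFormula Empty 2).iff
      (fLt (bvar 0) (bvar 1) ⊔ .equal (bvar 0) (bvar 1))).alls
  | induction (n : ℕ) (φ : LA.BoundedFormula Empty (n + 1)) :
      IsPAAxiom ((inst φ tZero).imp ((φ.imp (instSucc φ)).all.imp φ.all)).alls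

/-- Peano arithmetic. -/
def PA : LA.Theory := {σ | IsPAAxiom σ}

/-- `T` is an extension of Peano arithmetic: it proves all theorems of `PA`. -/
def ExtendsPA (T : LA.Theory) : Prop :=
  ∀ σ : LA.Sentence, ProvableSentence PA σ → ProvableSentence T σ

/-! ### Gödel numbers -/

/-- The Gödel number of a term. It is larger than those of the proper subterms. -/
def termCode {n : ℕ} : LA.Term (ℕ ⊕ Fin n) → ℕ
  | .var (Sum.inl a) => Nat.pair 0 a + 1
  | .var (Sum.inr i) => Nat.pair 1 i + 1
  | .func ArithFunc.zero _ => Nat.pair 2 0 + 1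
  | .func ArithFunc.succ ts => Nat.pair 3 (termCode (ts 0)) + 1
  | .func ArithFunc.add ts => Nat.pair 4 (Nat.pair (termCode (ts 0)) (termCode (ts 1))) + 1
  | .func ArithFunc.mul ts => Nat.pair 5 (Nat.pair (termCode (ts 0)) (termCode (ts 1))) + 1

/-- The Gödel number of a formula. It is larger than those of the proper subformulas and of the
terms that occur in it. -/
def formulaCode : ∀ {n : ℕ}, LA.BoundedFormula ℕ n → ℕ
  | _, .falsum => Nat.pair 6 0 + 1
  | _, .equal s t => Nat.pair 7 (Nat.pair (termCode s) (termCode t)) + 1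
  | _, .rel ArithRel.lt ts => Nat.pair 8 (Nat.pair (termCode (ts 0)) (termCode (ts 1))) + 1
  | _, .imp φ ψ => Nat.pair 9 (Nat.pair (formulaCode φ) (formulaCode ψ)) + 1
  | _, .all φ => Nat.pair 10 (formulaCode φ) + 1

/-- The Gödel number of a sentence, which is its Gödel number as a formula. -/
def sentenceCode (σ : LA.Sentence) : ℕ :=
  formulaCode (ofSentence σ : LA.Formula ℕ)

/-- `T` is primitive recursively axiomatized: the set of Gödel numbers of its axioms is
primitive recursive. -/
def PrimrecAxiomatized (T : LA.Theory) : Prop :=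
  PrimrecPred fun k : ℕ => ∃ σ ∈ T, sentenceCode σ = k

/-! ### The arithmetical hierarchy -/

section Hierarchy

variable {α : Type}

/-- The bounded quantification `∀ x < t, φ(x)`, where `x` does not occur in `t`. -/
def fBall {n : ℕ} (t : LA.Term (α ⊕ Fin n)) (φ : LA.BoundedFormula α (n + 1)) :
    LA.BoundedFormula α n :=
  ((fLt (bvar (Fin.last n)) (tLift t)).imp φ).all

/-- The bounded quantification `∃ x < t, φ(x)`, where `x` does not occur in `t`. -/
def fBex {n : ℕ} (t : LA.Term (α ⊕ Fin n)) (φ : LA.BoundedFormula α (n + 1)) :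
    LA.BoundedFormula α n :=
  (fLt (bvar (Fin.last n)) (tLift t) ⊓ φ).ex

/-- The formulas all of whose quantifiers are bounded. Negation, conjunction and disjunction are
composed of `⊥` and `→`. -/
inductive IsDelta0 : ∀ {n : ℕ}, LA.BoundedFormula α n → Prop
  | falsum {n : ℕ} : IsDelta0 (.falsum : LA.BoundedFormula α n)
  | equal {n : ℕ} (s t : LA.Term (α ⊕ Fin n)) : IsDelta0 (.equal s t)
  | rel {n l : ℕ} (R : LA.Relations l) (ts : Fin l → LA.Term (α ⊕ Fin n)) :
      IsDelta0 (.rel R ts)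
  | imp {n : ℕ} {φ ψ : LA.BoundedFormula α n} (h₁ : IsDelta0 φ) (h₂ : IsDelta0 ψ) :
      IsDelta0 (φ.imp ψ)
  | ball {n : ℕ} (t : LA.Term (α ⊕ Fin n)) {φ : LA.BoundedFormula α (n + 1)}
      (h : IsDelta0 φ) : IsDelta0 (fBall t φ)
  | bex {n : ℕ} (t : LA.Term (α ⊕ Fin n)) {φ : LA.BoundedFormula α (n + 1)}
      (h : IsDelta0 φ) : IsDelta0 (fBex t φ)

/-- The two sides of the first level of the arithmetical hierarchy. -/
inductive Side
  | sigma
  | pi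

/-- The opposite side. -/
def Side.dual : Side → Side
  | .sigma => .pi
  | .pi => .sigma

/-- The classes `Σ₁` and `Π₁`, defined simultaneously as the smallest classes that contain `Δ₀`,
are closed under `∧`, `∨` and under `∃` (for `Σ₁`) or `∀` (for `Π₁`), contain the negations of the
formulas of the other class, and contain `φ → ψ` for `φ` of the other class and `ψ` of the same
class. -/
inductive IsHier : Side → ∀ {n : ℕ}, LA.BoundedFormula α n → Prop
  | delta0 {p : Side} {n : ℕ} {φ : LA.BoundedFormula α n} (h : IsDelta0 φ) : IsHier p φ
  | and {p : Side} {n : ℕ} {φ ψ : LA.BoundedFormula α n} (h₁ : IsHier p φ)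
      (h₂ : IsHier p ψ) : IsHier p (φ ⊓ ψ)
  | or {p : Side} {n : ℕ} {φ ψ : LA.BoundedFormula α n} (h₁ : IsHier p φ)
      (h₂ : IsHier p ψ) : IsHier p (φ ⊔ ψ)
  | ex {n : ℕ} {φ : LA.BoundedFormula α (n + 1)} (h : IsHier .sigma φ) : IsHier .sigma φ.ex
  | all {n : ℕ} {φ : LA.BoundedFormula α (n + 1)} (h : IsHier .pi φ) : IsHier .pi φ.all
  | not {p : Side} {n : ℕ} {φ : LA.BoundedFormula α n} (h : IsHier p.dual φ) :
      IsHier p φ.not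
  | imp {p : Side} {n : ℕ} {φ ψ : LA.BoundedFormula α n} (h₁ : IsHier p.dual φ)
      (h₂ : IsHier p ψ) : IsHier p (φ.imp ψ)

/-- `φ` is a `Σ₁` formula. -/
def IsSigma1 {n : ℕ} (φ : LA.BoundedFormula α n) : Prop := IsHier .sigma φ

end Hierarchy

/-- `T` is `Σ₁`-sound: every `Σ₁` sentence provable in `T` is true in the standard model. -/
def Sigma1Sound (T : LA.Theory) : Prop :=
  ∀ σ : LA.Sentence, IsSigma1 σ → ProvableSentence T σ → ℕ ⊨ σ

/-! ### Provability predicates and provability logics -/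

/-- `PR(x)` is a provability predicate of `T`: for every formula `φ`,
`T ⊢ φ` if and only if `PA ⊢ PR(⌜φ⌝)`. -/
def IsProvabilityPredicate (T : LA.Theory) (PR : LA.Formula (Fin 1)) : Prop :=
  ∀ φ : LA.Formula ℕ,
    Provable T φ ↔ ProvableSentence PA (applyNumeral PR (formulaCode φ))

/-- Formulas of propositional modal logic. -/
inductive MF
  | var (p : ℕ)
  | bot
  | neg (A : MF)
  | and (A B : MF)
  | or (A B : MF)
  | imp (A B : MF)
  | box (A : MF)

/-- `□ⁿ A`. -/
def MF.boxes : ℕ → MF → MF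
  | 0, A => A
  | n + 1, A => MF.box (MF.boxes n A)

/-- `f` is an arithmetical interpretation based on `PR`. -/
structure IsArithInterp (PR : LA.Formula (Fin 1)) (f : MF → LA.Sentence) : Prop where
  bot : f .bot = .equal (numeral 0) (numeral 1)
  neg : ∀ A, f (.neg A) = (f A).not
  and : ∀ A B, f (.and A B) = f A ⊓ f B
  or : ∀ A B, f (.or A B) = f A ⊔ f B
  imp : ∀ A B, f (.imp A B) = (f A).imp (f B)
  box : ∀ A, f (.box A) = applyNumeral PR (sentenceCode (f A))

/-- The provability logic of `PR`, as a provability predicate of `T`. -/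
def PL (T : LA.Theory) (PR : LA.Formula (Fin 1)) : Set MF :=
  {A | ∀ f : MF → LA.Sentence, IsArithInterp PR f → ProvableSentence T (f A)}

/-- The truth value of a modal formula under an assignment of truth values to the
propositional variables and the formulas `□ A`. -/
def MF.truth (v : ℕ → Prop) (w : MF → Prop) : MF → Prop
  | .var p => v p
  | .bot => False
  | .neg A => ¬ A.truth v w
  | .and A B => A.truth v w ∧ B.truth v w
  | .or A B => A.truth v w ∨ B.truth v w
  | .imp A B => A.truth v w → B.truth v w
  | .box A => w A

/-- `A` is a propositional tautology in the modal language. -/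
def MF.IsTautology (A : MF) : Prop := ∀ (v : ℕ → Prop) (w : MF → Prop), A.truth v w

/-- Derivability in the logic `N⁺A_{m,n}`: the pure logic of necessitation (tautologies,
modus ponens, necessitation) with the axioms `□ⁿ A → □ᵐ A` and the rule `¬ □ A / ¬ □ □ A`. -/
inductive NPlusADerives (m n : ℕ) : MF → Prop
  | taut {A : MF} (h : A.IsTautology) : NPlusADerives m n A
  | acc (A : MF) : NPlusADerives m n (.imp (MF.boxes n A) (MF.boxes m A))
  | mp {A B : MF} (h₁ : NPlusADerives m n A) (h₂ : NPlusADerives m n (.imp A B)) : NPlusADerives m n B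
  | nec {A : MF} (h : NPlusADerives m n A) : NPlusADerives m n (.box A)
  | ros {A : MF} (h : NPlusADerives m n (.neg (.box A))) : NPlusADerives m n (.neg (.box (.box A)))

/-- The logic `N⁺A_{m,n}`, as its set of theorems. -/
def NPlusA (m n : ℕ) : Set MF := {A | NPlusADerives m n A}

end ProvLogic

namespace ProvLogic

open FirstOrder FirstOrder.Language

/-! ### Substitution -/

section Substitution

variable {α β γ : Type}

/-! Suppose that `T` proves every instance of `p → □ᵐ p`. Take a sentence σ that `T` neither proves
nor refutes. The instances for σ and ¬σ give, by excluded middle, `T ⊢ □ᵐσ ∨ □ᵐ¬σ`. Since m ≥ 1,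
both disjuncts are values of `PR`, so the disjunction is Σ₁ and therefore true, and so is one of the
disjuncts. A true `PR(⌜τ⌝)` means `T ⊢ τ` (`provableSentence_iff_realize`), so the boxes can be
peeled off one at a time (`provableSentence_of_realize_boxes`), and `T` decides σ after all.

Two classical facts carry this. The first is Σ₁-completeness of `PA` (`IsHier.derives`), which turns
the truth of `PR(⌜τ⌝)` into its provability in `PA`, hence into `T ⊢ τ`. The second is
incompleteness (`exists_undecidable`). As `T` is Σ₁-sound, a Gödel sentence suffices and Rosser's
trick is not needed. Moreover the fixed point has to hold only in the standard model, not provably,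
so the diagonal lemma need not be formalized in `PA`. The sentence has the form ∀x (x = e → ¬θ(x)),
with e the code of ¬θ: its code is an explicit function of e, and the only recursion to be
arithmetized is the one for the codes of numerals. -/

theorem term_subst_subst {δ : Type} (t : LA.Term α) (f : α → LA.Term γ)
    (g : γ → LA.Term δ) : (t.subst f).subst g = t.subst fun x => (f x).subst g := by
  induction t with
  | var x => rfl
  | func F ts ih => simp only [Term.subst, ih]

theorem term_subst_var (t : LA.Term α) : t.subst Term.var = t := by
  induction t with
  | var x => rfl
  | func F ts ih => simp only [Term.subst, ih]

theorem tLift_eq_subst {n : ℕ} (t : LA.Term (α ⊕ Fin n)) :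
    tLift t = t.subst fun x => tLift (Term.var x) := by
  induction t with
  | var x => rfl
  | func F ts ih =>
    simp only [tLift, Term.relabel, Term.subst] at ih ⊢
    simp only [ih]

@[simp]
theorem tLift_bvar {n : ℕ} (i : Fin n) :
    tLift (bvar i : LA.Term (α ⊕ Fin n)) = bvar i.castSucc := rfl

theorem subst_tLift {n m : ℕ} (t : LA.Term (α ⊕ Fin n))
    (f : α ⊕ Fin (n + 1) → LA.Term (β ⊕ Fin m)) :
    (tLift t).subst f = t.subst (Sum.elim (fun a => f (Sum.inl a))
      fun i => f (Sum.inr i.castSucc)) := by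
  rw [tLift_eq_subst, term_subst_subst]
  congr 1
  funext x
  rcases x with a | i <;> rfl

@[simp]
theorem subst_tZero (f : α → LA.Term β) : (tZero : LA.Term α).subst f = tZero := by
  simp only [tZero, Term.subst]
  congr 1
  exact Subsingleton.elim _ _

@[simp]
theorem subst_tSucc (f : α → LA.Term β) (t : LA.Term α) :
    (tSucc t).subst f = tSucc (t.subst f) := by
  simp only [tSucc, Term.subst]
  congr 1
  funext i
  fin_cases i
  rfl

@[simp]
theorem subst_tAdd (f : α → LA.Term β) (s t : LA.Term α) :
    (tAdd s t).subst f = tAdd (s.subst f) (t.subst f) := by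
  simp only [tAdd, Term.subst]
  congr 1
  funext i
  fin_cases i <;> rfl

@[simp]
theorem subst_tMul (f : α → LA.Term β) (s t : LA.Term α) :
    (tMul s t).subst f = tMul (s.subst f) (t.subst f) := by
  simp only [tMul, Term.subst]
  congr 1
  funext i
  fin_cases i <;> rfl

@[simp]
theorem subst_bvar {n : ℕ} (f : α ⊕ Fin n → LA.Term β) (i : Fin n) :
    (bvar i : LA.Term (α ⊕ Fin n)).subst f = f (Sum.inr i) := rfl

@[simp]
theorem subst_numeral (f : α → LA.Term β) (k : ℕ) :
    (numeral k : LA.Term α).subst f = numeral k := by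
  induction k with
  | zero => exact subst_tZero f
  | succ k ih => simp only [numeral, subst_tSucc, ih]

@[simp]
theorem tLift_numeral {n : ℕ} (k : ℕ) :
    tLift (numeral k : LA.Term (α ⊕ Fin n)) = numeral k := by
  rw [tLift_eq_subst, subst_numeral]

@[simp]
theorem fSubst_equal {n m : ℕ} (f : α ⊕ Fin n → LA.Term (β ⊕ Fin m))
    (s t : LA.Term (α ⊕ Fin n)) :
    fSubst f (.equal s t) = .equal (s.subst f) (t.subst f) := rfl

@[simp]
theorem fSubst_fLt {n m : ℕ} (f : α ⊕ Fin n → LA.Term (β ⊕ Fin m))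
    (s t : LA.Term (α ⊕ Fin n)) : fSubst f (fLt s t) = fLt (s.subst f) (t.subst f) := by
  simp only [fLt, fSubst]
  congr 1
  funext i
  fin_cases i <;> rfl

@[simp]
theorem fSubst_imp {n m : ℕ} (f : α ⊕ Fin n → LA.Term (β ⊕ Fin m))
    (φ ψ : LA.BoundedFormula α n) : fSubst f (φ.imp ψ) = (fSubst f φ).imp (fSubst f ψ) := rfl

@[simp]
theorem fSubst_not {n m : ℕ} (f : α ⊕ Fin n → LA.Term (β ⊕ Fin m))
    (φ : LA.BoundedFormula α n) : fSubst f φ.not = (fSubst f φ).not := rfl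

@[simp]
theorem fSubst_inf {n m : ℕ} (f : α ⊕ Fin n → LA.Term (β ⊕ Fin m))
    (φ ψ : LA.BoundedFormula α n) : fSubst f (φ ⊓ ψ) = fSubst f φ ⊓ fSubst f ψ := rfl

@[simp]
theorem fSubst_sup {n m : ℕ} (f : α ⊕ Fin n → LA.Term (β ⊕ Fin m))
    (φ ψ : LA.BoundedFormula α n) : fSubst f (φ ⊔ ψ) = fSubst f φ ⊔ fSubst f ψ := rfl

@[simp]
theorem fSubst_iff {n m : ℕ} (f : α ⊕ Fin n → LA.Term (β ⊕ Fin m))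
    (φ ψ : LA.BoundedFormula α n) : fSubst f (φ.iff ψ) = (fSubst f φ).iff (fSubst f ψ) := rfl

@[simp]
theorem fSubst_all {n m : ℕ} (f : α ⊕ Fin n → LA.Term (β ⊕ Fin m))
    (φ : LA.BoundedFormula α (n + 1)) : fSubst f φ.all = (fSubst (liftSubst f) φ).all := rfl

@[simp]
theorem fSubst_ex {n m : ℕ} (f : α ⊕ Fin n → LA.Term (β ⊕ Fin m))
    (φ : LA.BoundedFormula α (n + 1)) : fSubst f φ.ex = (fSubst (liftSubst f) φ).ex := rfl

theorem tLift_subst {n m : ℕ} (f : α ⊕ Fin n → LA.Term (β ⊕ Fin m))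
    (t : LA.Term (α ⊕ Fin n)) : (tLift t).subst (liftSubst f) = tLift (t.subst f) := by
  rw [subst_tLift, tLift_eq_subst (t.subst f), term_subst_subst]
  congr 1
  funext x
  rcases x with a | i
  · exact tLift_eq_subst _
  · simp only [liftSubst, Sum.elim_inr, Fin.snoc_castSucc]
    exact tLift_eq_subst _

@[simp]
theorem liftSubst_last {n m : ℕ} (f : α ⊕ Fin n → LA.Term (β ⊕ Fin m)) :
    liftSubst f (Sum.inr (Fin.last n)) = bvar (Fin.last m) := by
  simp [liftSubst]

@[simp]
theorem fSubst_fBall {n m : ℕ} (f : α ⊕ Fin n → LA.Term (β ⊕ Fin m))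
    (t : LA.Term (α ⊕ Fin n)) (φ : LA.BoundedFormula α (n + 1)) :
    fSubst f (fBall t φ) = fBall (t.subst f) (fSubst (liftSubst f) φ) := by
  simp [fBall, tLift_subst]

@[simp]
theorem fSubst_fBex {n m : ℕ} (f : α ⊕ Fin n → LA.Term (β ⊕ Fin m))
    (t : LA.Term (α ⊕ Fin n)) (φ : LA.BoundedFormula α (n + 1)) :
    fSubst f (fBex t φ) = fBex (t.subst f) (fSubst (liftSubst f) φ) := by
  simp [fBex, tLift_subst]

theorem liftSubst_comp {n m l : ℕ} (f : α ⊕ Fin n → LA.Term (β ⊕ Fin m))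
    (g : β ⊕ Fin m → LA.Term (γ ⊕ Fin l)) :
    (fun x => (liftSubst f x).subst (liftSubst g)) = liftSubst fun x => (f x).subst g := by
  funext x
  rcases x with a | i
  · exact tLift_subst _ _
  · refine Fin.lastCases ?_ (fun i => ?_) i
    · simp [liftSubst]
    · simp only [liftSubst, Sum.elim_inr, Fin.snoc_castSucc]
      exact tLift_subst _ _

theorem fSubst_fSubst {n m l : ℕ} (f : α ⊕ Fin n → LA.Term (β ⊕ Fin m))
    (g : β ⊕ Fin m → LA.Term (γ ⊕ Fin l)) (φ : LA.BoundedFormula α n) :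
    fSubst g (fSubst f φ) = fSubst (fun x => (f x).subst g) φ := by
  induction φ generalizing m l with
  | falsum => rfl
  | equal s t => simp only [fSubst, term_subst_subst]
  | rel R ts => simp only [fSubst, term_subst_subst]
  | imp φ ψ ih₁ ih₂ => simp only [fSubst, ih₁, ih₂]
  | all φ ih => simp only [fSubst, ih, liftSubst_comp]

/-- Merges ∀-elimination after a substitution into one simultaneous substitution: lifted terms do
not contain the last variable, so instantiating it leaves them as they were. -/
theorem inst_fSubst_liftSubst {n m : ℕ} (f : α ⊕ Fin n → LA.Term (β ⊕ Fin m))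
    (φ : LA.BoundedFormula α (n + 1)) (t : LA.Term (β ⊕ Fin m)) :
    inst (fSubst (liftSubst f) φ) t =
      fSubst (Sum.elim (fun a => f (Sum.inl a)) (Fin.snoc (fun i => f (Sum.inr i)) t)) φ := by
  have key : ∀ s : LA.Term (β ⊕ Fin m),
      (tLift s).subst (Sum.elim (fun a => Term.var (Sum.inl a)) (Fin.snoc bvar t)) = s := by
    intro s
    rw [subst_tLift]
    conv_rhs => rw [← term_subst_var s]
    congr 1
    funext x
    rcases x with a | i
    · rfl
    · simp [bvar]
  rw [inst, fSubst_fSubst]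
  congr 1
  funext x
  rcases x with a | i
  · exact key _
  · refine Fin.lastCases ?_ (fun i => ?_) i
    · simp [liftSubst]
    · simp only [liftSubst, Sum.elim_inr, Fin.snoc_castSucc]
      exact key _

theorem weaken_fSubst {n m : ℕ} (f : α ⊕ Fin n → LA.Term (β ⊕ Fin m))
    (φ : LA.BoundedFormula α n) : weaken (fSubst f φ) = fSubst (fun x => tLift (f x)) φ := by
  rw [weaken, fSubst_fSubst]
  congr 1
  funext x
  exact (tLift_eq_subst _).symm

/-- The bound of a bounded quantifier is a lifted term, and lifting commutes with substitution
(`tLift_subst`), so bounded quantifiers stay bounded. -/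
theorem IsDelta0.subst {n m : ℕ} {φ : LA.BoundedFormula α n} (h : IsDelta0 φ)
    (f : α ⊕ Fin n → LA.Term (β ⊕ Fin m)) : IsDelta0 (fSubst f φ) := by
  induction h generalizing m with
  | falsum => exact .falsum
  | equal s t => exact .equal _ _
  | rel R ts => exact .rel _ _
  | imp _ _ ih₁ ih₂ => exact .imp (ih₁ f) (ih₂ f)
  | ball t _ ih =>
    rw [fSubst_fBall]
    exact .ball _ (ih _)
  | bex t _ ih =>
    rw [fSubst_fBex]
    exact .bex _ (ih _)

theorem IsHier.subst {p : Side} {n m : ℕ} {φ : LA.BoundedFormula α n} (h : IsHier p φ)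
    (f : α ⊕ Fin n → LA.Term (β ⊕ Fin m)) : IsHier p (fSubst f φ) := by
  induction h generalizing m with
  | delta0 h => exact .delta0 (h.subst f)
  | and _ _ ih₁ ih₂ => exact .and (ih₁ f) (ih₂ f)
  | or _ _ ih₁ ih₂ => exact .or (ih₁ f) (ih₂ f)
  | ex _ ih => exact .ex (ih _)
  | all _ ih => exact .all (ih _)
  | not _ ih => exact .not (ih f)
  | imp _ _ ih₁ ih₂ => exact .imp (ih₁ f) (ih₂ f)

end Substitution

/-! ### Evaluation in the standard model -/

section Semantics

variable {α β : Type}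

@[simp]
theorem realize_tZero (v : α → ℕ) : (tZero : LA.Term α).realize v = 0 := rfl

@[simp]
theorem realize_tSucc (v : α → ℕ) (t : LA.Term α) :
    (tSucc t).realize v = t.realize v + 1 := rfl

@[simp]
theorem realize_tAdd (v : α → ℕ) (s t : LA.Term α) :
    (tAdd s t).realize v = s.realize v + t.realize v := rfl

@[simp]
theorem realize_tMul (v : α → ℕ) (s t : LA.Term α) :
    (tMul s t).realize v = s.realize v * t.realize v := rfl

@[simp]
theorem realize_numeral (v : α → ℕ) (k : ℕ) : (numeral k : LA.Term α).realize v = k := by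
  induction k with
  | zero => rfl
  | succ k ih => simp [numeral, ih]

@[simp]
theorem realize_bvar {n : ℕ} (v : α → ℕ) (xs : Fin n → ℕ) (i : Fin n) :
    (bvar i : LA.Term (α ⊕ Fin n)).realize (Sum.elim v xs) = xs i := rfl

@[simp]
theorem realize_tLift {n : ℕ} (v : α → ℕ) (xs : Fin n → ℕ) (k : ℕ)
    (t : LA.Term (α ⊕ Fin n)) :
    (tLift t).realize (Sum.elim v (Fin.snoc xs k : Fin (n + 1) → ℕ)) =
      t.realize (Sum.elim v xs) := by
  rw [tLift, Term.realize_relabel]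
  congr 1
  funext x
  rcases x with a | i <;> simp

@[simp]
theorem realize_fLt {n : ℕ} (v : α → ℕ) (xs : Fin n → ℕ) (s t : LA.Term (α ⊕ Fin n)) :
    (fLt s t).Realize v xs ↔ s.realize (Sum.elim v xs) < t.realize (Sum.elim v xs) :=
  Iff.rfl

@[simp]
theorem realize_equal {n : ℕ} (v : α → ℕ) (xs : Fin n → ℕ) (s t : LA.Term (α ⊕ Fin n)) :
    (BoundedFormula.equal s t).Realize v xs ↔
      s.realize (Sum.elim v xs) = t.realize (Sum.elim v xs) :=
  Iff.rfl

@[simp]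
theorem realize_fBall {n : ℕ} (v : α → ℕ) (xs : Fin n → ℕ) (t : LA.Term (α ⊕ Fin n))
    (φ : LA.BoundedFormula α (n + 1)) :
    (fBall t φ).Realize v xs ↔
      ∀ k < t.realize (Sum.elim v xs), φ.Realize v (Fin.snoc xs k) := by
  simp [fBall]

@[simp]
theorem realize_fBex {n : ℕ} (v : α → ℕ) (xs : Fin n → ℕ) (t : LA.Term (α ⊕ Fin n))
    (φ : LA.BoundedFormula α (n + 1)) :
    (fBex t φ).Realize v xs ↔
      ∃ k < t.realize (Sum.elim v xs), φ.Realize v (Fin.snoc xs k) := by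
  simp [fBex]

theorem realize_fSubst {n m : ℕ} (f : α ⊕ Fin n → LA.Term (β ⊕ Fin m))
    (φ : LA.BoundedFormula α n) (v : β → ℕ) (xs : Fin m → ℕ) :
    (fSubst f φ).Realize v xs ↔
      φ.Realize (fun a => (f (Sum.inl a)).realize (Sum.elim v xs))
        (fun i => (f (Sum.inr i)).realize (Sum.elim v xs)) := by
  have hf : ∀ {n m : ℕ} (f : α ⊕ Fin n → LA.Term (β ⊕ Fin m)) (xs : Fin m → ℕ),
      (fun x => (f x).realize (Sum.elim v xs)) =
        Sum.elim (fun a => (f (Sum.inl a)).realize (Sum.elim v xs))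
          (fun i => (f (Sum.inr i)).realize (Sum.elim v xs)) := by
    intro n m f xs
    funext x
    rcases x with a | i <;> rfl
  induction φ generalizing m with
  | falsum => rfl
  | equal s t => simp only [fSubst, realize_equal, Term.realize_subst, hf]
  | rel R ts =>
    simp only [fSubst, BoundedFormula.Realize, Term.realize_subst, hf]
  | imp φ ψ ih₁ ih₂ => simp only [fSubst, BoundedFormula.realize_imp, ih₁, ih₂]
  | all φ ih =>
    simp only [fSubst, BoundedFormula.realize_all, ih]
    refine forall_congr' fun k => ?_
    apply iff_of_eq
    congr 1
    · funext a
      simp [liftSubst]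
    · funext i
      refine Fin.lastCases ?_ (fun i => ?_) i <;> simp [liftSubst]

theorem sentence_realize_iff (σ : LA.Sentence) (v : Empty → ℕ) (xs : Fin 0 → ℕ) :
    ℕ ⊨ σ ↔ BoundedFormula.Realize σ v xs := by
  apply iff_of_eq
  unfold Sentence.Realize Formula.Realize
  congr 1 <;> exact Subsingleton.elim _ _

end Semantics

/-! ### Derived rules -/

namespace Derives

section Rules

variable {T : LA.Theory} {n : ℕ} {Γ Δ : Set (LA.BoundedFormula ℕ n)}
  {φ ψ χ : LA.BoundedFormula ℕ n}

theorem mono (h : Derives T Γ φ) (hΓ : Γ ⊆ Δ) : Derives T Δ φ := by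
  induction h with
  | hyp h => exact .hyp (hΓ h)
  | ax h => exact .ax h
  | impI _ ih => exact .impI (ih (Set.insert_subset_insert hΓ))
  | impE _ _ ih₁ ih₂ => exact .impE (ih₁ hΓ) (ih₂ hΓ)
  | raa _ ih => exact .raa (ih (Set.insert_subset_insert hΓ))
  | allI _ ih => exact .allI (ih (Set.image_mono hΓ))
  | allE _ t ih => exact .allE (ih hΓ) t
  | eqRefl t => exact .eqRefl t
  | eqSubst φ _ _ ih₁ ih₂ => exact .eqSubst φ (ih₁ hΓ) (ih₂ hΓ)

theorem insert (h : Derives T Γ φ) : Derives T (insert ψ Γ) φ :=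
  h.mono (Set.subset_insert _ _)

theorem head : Derives T (Insert.insert φ Γ) φ := .hyp (Set.mem_insert _ _)

theorem cut (h₁ : Derives T Γ φ) (h₂ : Derives T (Insert.insert φ Γ) ψ) : Derives T Γ ψ :=
  .impE (.impI h₂) h₁

theorem exfalso (h : Derives T Γ ⊥) : Derives T Γ φ := .raa h.insert

theorem absurd (h₁ : Derives T Γ φ.not) (h₂ : Derives T Γ φ) : Derives T Γ ψ :=
  exfalso (.impE h₁ h₂)

theorem notI (h : Derives T (Insert.insert φ Γ) ⊥) : Derives T Γ φ.not := .impI h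

theorem imp_of_not (h : Derives T Γ φ.not) : Derives T Γ (φ.imp ψ) :=
  .impI (absurd h.insert head)

theorem imp_of_right (h : Derives T Γ ψ) : Derives T Γ (φ.imp ψ) := .impI h.insert

theorem not_imp (h₁ : Derives T Γ φ) (h₂ : Derives T Γ ψ.not) : Derives T Γ (φ.imp ψ).not :=
  notI (.impE h₂.insert (.impE head h₁.insert))

theorem not_not (h : Derives T Γ φ) : Derives T Γ φ.not.not :=
  notI (.impE head h.insert)

/-- The rules for the defined connectives rely on definitional unfolding: `φ ⊓ ψ` is ¬(φ → ¬ψ), and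
`φ ⊔ ψ` is ¬φ → ψ. -/
theorem andI (h₁ : Derives T Γ φ) (h₂ : Derives T Γ ψ) : Derives T Γ (φ ⊓ ψ) :=
  not_imp h₁ h₂.not_not

theorem andE_left (h : Derives T Γ (φ ⊓ ψ)) : Derives T Γ φ :=
  .raa (.impE h.insert (imp_of_not head))

theorem andE_right (h : Derives T Γ (φ ⊓ ψ)) : Derives T Γ ψ :=
  .raa (.impE h.insert (imp_of_right head))

theorem orI_left (h : Derives T Γ φ) : Derives T Γ (φ ⊔ ψ) := imp_of_not h.not_not

theorem orI_right (h : Derives T Γ ψ) : Derives T Γ (φ ⊔ ψ) := imp_of_right h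

theorem orE (h : Derives T Γ (φ ⊔ ψ)) (h₁ : Derives T (Insert.insert φ Γ) χ)
    (h₂ : Derives T (Insert.insert ψ Γ) χ) : Derives T Γ χ := by
  have hφ : Derives T (Insert.insert χ.not Γ) φ.not :=
    notI (.impE head.insert (h₁.mono (Set.insert_subset_insert (Set.subset_insert _ _))))
  have hψ : Derives T (Insert.insert χ.not Γ) ψ.not :=
    notI (.impE head.insert (h₂.mono (Set.insert_subset_insert (Set.subset_insert _ _))))
  exact .raa (.impE hψ (.impE h.insert hφ))

theorem not_or (h₁ : Derives T Γ φ.not) (h₂ : Derives T Γ ψ.not) : Derives T Γ (φ ⊔ ψ).not :=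
  not_imp h₁ h₂

theorem not_and_left (h : Derives T Γ φ.not) : Derives T Γ (φ ⊓ ψ).not :=
  not_not (imp_of_not h)

theorem not_and_right (h : Derives T Γ ψ.not) : Derives T Γ (φ ⊓ ψ).not :=
  not_not (imp_of_right h)

theorem iffE_left (h : Derives T Γ (φ.iff ψ)) : Derives T Γ (φ.imp ψ) := andE_left h

theorem iffE_right (h : Derives T Γ (φ.iff ψ)) : Derives T Γ (ψ.imp φ) := andE_right h

theorem not_all {θ : LA.BoundedFormula ℕ (n + 1)} {t : LA.Term (ℕ ⊕ Fin n)}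
    (h : Derives T Γ (inst θ t).not) : Derives T Γ θ.all.not :=
  notI (.impE h.insert (allE head t))

/-- The cut rule for finitely many cut formulas at once. -/
theorem cut_of_forall_lt {N : ℕ} {θ : ℕ → LA.BoundedFormula ℕ n}
    (h : ∀ k < N, Derives T Γ (θ k))
    (hφ : Derives T (Γ ∪ θ '' Set.Iio N) φ) : Derives T Γ φ := by
  induction N with
  | zero => simpa using hφ
  | succ N ih =>
    refine ih (fun k hk => h k (by omega)) (cut (φ := θ N) ?_ (hφ.mono ?_))
    · exact (h N (by omega)).mono Set.subset_union_left
    · rintro χ (hχ | ⟨k, hk, rfl⟩)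
      · exact Or.inr (Or.inl hχ)
      · rcases Nat.lt_succ_iff_lt_or_eq.mp hk with hk | rfl
        · exact Or.inr (Or.inr ⟨k, hk, rfl⟩)
        · exact Or.inl rfl

end Rules

/-! ### Congruence rules for equality, and instances of axioms. -/

section Equality

variable {T : LA.Theory} {n : ℕ} {Γ : Set (LA.BoundedFormula ℕ n)}
  {r s t s' t' : LA.Term (ℕ ⊕ Fin n)}

theorem inst_subst_tLift (s t : LA.Term (ℕ ⊕ Fin n)) :
    (tLift s).subst (Sum.elim (fun a => Term.var (Sum.inl a)) (Fin.snoc bvar t)) = s := by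
  rw [subst_tLift]
  conv_rhs => rw [← term_subst_var s]
  congr 1
  funext x
  rcases x with a | i
  · rfl
  · simp [bvar]

/-- Here and in the congruences below, Leibniz's rule is applied once for each rewritten argument,
to a formula whose last variable marks the place to rewrite; all other terms are lifted, so that
instantiation does not affect them. -/
theorem eq_symm (h : Derives T Γ (.equal s t)) : Derives T Γ (.equal t s) := by
  have := eqSubst (.equal (bvar (Fin.last n)) (tLift s)) h (by
    simpa [inst, inst_subst_tLift] using eqRefl s)
  simpa [inst, inst_subst_tLift] using this

theorem eq_trans (h₁ : Derives T Γ (.equal r s)) (h₂ : Derives T Γ (.equal s t)) :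
    Derives T Γ (.equal r t) := by
  have := eqSubst (.equal (tLift r) (bvar (Fin.last n))) h₂ (by
    simpa [inst, inst_subst_tLift] using h₁)
  simpa [inst, inst_subst_tLift] using this

theorem eq_succ (h : Derives T Γ (.equal s t)) :
    Derives T Γ (.equal (tSucc s) (tSucc t)) := by
  have := eqSubst (.equal (tLift (tSucc s)) (tSucc (bvar (Fin.last n)))) h (by
    simpa [inst, inst_subst_tLift] using eqRefl (tSucc s))
  simpa [inst, inst_subst_tLift] using this

theorem eq_add (h₁ : Derives T Γ (.equal s s')) (h₂ : Derives T Γ (.equal t t')) :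
    Derives T Γ (.equal (tAdd s t) (tAdd s' t')) := by
  have h₁ := eqSubst (.equal (tLift (tAdd s t)) (tAdd (bvar (Fin.last n)) (tLift t))) h₁ (by
    simpa [inst, inst_subst_tLift] using eqRefl (tAdd s t))
  have h₂ := eqSubst (.equal (tLift (tAdd s t)) (tAdd (tLift s') (bvar (Fin.last n)))) h₂ (by
    simpa [inst, inst_subst_tLift] using h₁)
  simpa [inst, inst_subst_tLift] using h₂

theorem eq_mul (h₁ : Derives T Γ (.equal s s')) (h₂ : Derives T Γ (.equal t t')) :
    Derives T Γ (.equal (tMul s t) (tMul s' t')) := by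
  have h₁ := eqSubst (.equal (tLift (tMul s t)) (tMul (bvar (Fin.last n)) (tLift t))) h₁ (by
    simpa [inst, inst_subst_tLift] using eqRefl (tMul s t))
  have h₂ := eqSubst (.equal (tLift (tMul s t)) (tMul (tLift s') (bvar (Fin.last n)))) h₂ (by
    simpa [inst, inst_subst_tLift] using h₁)
  simpa [inst, inst_subst_tLift] using h₂

theorem lt_congr (h₁ : Derives T Γ (.equal s s')) (h₂ : Derives T Γ (.equal t t'))
    (h : Derives T Γ (fLt s t)) : Derives T Γ (fLt s' t') := by
  have h₁ := eqSubst (fLt (bvar (Fin.last n)) (tLift t)) h₁ (by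
    simpa [inst, inst_subst_tLift] using h)
  have h₂ := eqSubst (fLt (tLift s') (bvar (Fin.last n))) h₂ (by
    simpa [inst, inst_subst_tLift] using h₁)
  simpa [inst, inst_subst_tLift] using h₂

/-- Serves to read off the instances of the axioms of `PA`, which are universal closures. -/
theorem allE_ofSentence {φ : LA.BoundedFormula Empty 1}
    (h : Derives T Γ (ofSentence φ.all)) (t : LA.Term (ℕ ⊕ Fin n)) :
    Derives T Γ (fSubst (Sum.elim Empty.elim ![t]) φ) := by
  have := allE (φ := fSubst (liftSubst (Sum.elim Empty.elim Fin.elim0)) φ) h t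
  rw [inst_fSubst_liftSubst] at this
  convert this using 2
  funext x
  rcases x with a | i
  · exact a.elim
  · fin_cases i
    rfl

theorem allE_allE_ofSentence {φ : LA.BoundedFormula Empty 2}
    (h : Derives T Γ (ofSentence φ.all.all)) (s t : LA.Term (ℕ ⊕ Fin n)) :
    Derives T Γ (fSubst (Sum.elim Empty.elim ![s, t]) φ) := by
  have := (allE_ofSentence h s).allE (φ := fSubst (liftSubst _) φ) t
  rw [inst_fSubst_liftSubst] at this
  convert this using 2
  funext x
  rcases x with a | i
  · exact a.elim
  · fin_cases i <;> rfl

end Equality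

/-! ### Arithmetic of numerals in Peano arithmetic -/

section Arithmetic

variable {n : ℕ} {Γ : Set (LA.BoundedFormula ℕ n)}

theorem succ_ne_zero (t : LA.Term (ℕ ⊕ Fin n)) :
    Derives PA Γ (BoundedFormula.equal (tSucc t) tZero).not := by
  simpa using allE_ofSentence (.ax (T := PA) IsPAAxiom.succ_ne_zero) t

theorem succ_inj (s t : LA.Term (ℕ ⊕ Fin n)) :
    Derives PA Γ ((BoundedFormula.equal (tSucc s) (tSucc t)).imp (.equal s t)) := by
  simpa using allE_allE_ofSentence (.ax (T := PA) IsPAAxiom.succ_inj) s t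

theorem add_zero (t : LA.Term (ℕ ⊕ Fin n)) :
    Derives PA Γ (.equal (tAdd t tZero) t) := by
  simpa using allE_ofSentence (.ax (T := PA) IsPAAxiom.add_zero) t

theorem add_succ (s t : LA.Term (ℕ ⊕ Fin n)) :
    Derives PA Γ (.equal (tAdd s (tSucc t)) (tSucc (tAdd s t))) := by
  simpa using allE_allE_ofSentence (.ax (T := PA) IsPAAxiom.add_succ) s t

theorem mul_zero (t : LA.Term (ℕ ⊕ Fin n)) :
    Derives PA Γ (.equal (tMul t tZero) tZero) := by
  simpa using allE_ofSentence (.ax (T := PA) IsPAAxiom.mul_zero) t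

theorem mul_succ (s t : LA.Term (ℕ ⊕ Fin n)) :
    Derives PA Γ (.equal (tMul s (tSucc t)) (tAdd (tMul s t) s)) := by
  simpa using allE_allE_ofSentence (.ax (T := PA) IsPAAxiom.mul_succ) s t

theorem not_lt_zero (t : LA.Term (ℕ ⊕ Fin n)) : Derives PA Γ (fLt t tZero).not := by
  simpa using allE_ofSentence (.ax (T := PA) IsPAAxiom.not_lt_zero) t

theorem lt_succ (s t : LA.Term (ℕ ⊕ Fin n)) :
    Derives PA Γ ((fLt s (tSucc t)).iff (fLt s t ⊔ .equal s t)) := by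
  simpa using allE_allE_ofSentence (.ax (T := PA) IsPAAxiom.lt_succ) s t

theorem numeral_add (k l : ℕ) :
    Derives PA Γ (.equal (tAdd (numeral k) (numeral l)) (numeral (k + l))) := by
  induction l with
  | zero => exact add_zero _
  | succ l ih => exact (add_succ _ _).eq_trans ih.eq_succ

theorem numeral_mul (k l : ℕ) :
    Derives PA Γ (.equal (tMul (numeral k) (numeral l)) (numeral (k * l))) := by
  induction l with
  | zero => exact mul_zero _
  | succ l ih =>
    exact (mul_succ _ _).eq_trans ((ih.eq_add (eqRefl _)).eq_trans (numeral_add _ _))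

theorem numeral_ne {k l : ℕ} (h : k ≠ l) :
    Derives PA Γ (BoundedFormula.equal (numeral k) (numeral l)).not := by
  induction k generalizing l with
  | zero =>
    obtain ⟨l, rfl⟩ := Nat.exists_eq_succ_of_ne_zero h.symm
    exact notI (.impE (succ_ne_zero _) head.eq_symm)
  | succ k ih =>
    cases l with
    | zero => exact succ_ne_zero _
    | succ l =>
      exact notI (.impE (ih (l := l) (by omega)).insert (.impE (succ_inj _ _) head))

theorem numeral_lt {k l : ℕ} (h : k < l) : Derives PA Γ (fLt (numeral k) (numeral l)) := by
  induction l with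
  | zero => omega
  | succ l ih =>
    refine .impE (lt_succ _ _).iffE_right ?_
    rcases Nat.lt_succ_iff_lt_or_eq.mp h with h | rfl
    · exact (ih h).orI_left
    · exact (eqRefl _).orI_right

theorem numeral_not_lt {k l : ℕ} (h : ¬ k < l) :
    Derives PA Γ (fLt (numeral k) (numeral l)).not := by
  induction l with
  | zero => exact not_lt_zero _
  | succ l ih =>
    refine notI (orE (.impE (lt_succ _ _).iffE_left head) ?_ ?_)
    · exact .impE (ih (by omega)).insert.insert head
    · exact .impE (numeral_ne (by omega)) head

/-- The term `t`, with `v` and `xs` as the values of its variables, is provably equal to the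
numeral of its value. -/
theorem term_eval {α : Type} {l : ℕ} (v : α ⊕ Fin l → ℕ) (t : LA.Term (α ⊕ Fin l)) :
    Derives PA Γ (.equal (t.subst fun x => numeral (v x)) (numeral (t.realize v))) := by
  induction t with
  | var x => exact eqRefl _
  | func F ts ih =>
    cases F with
    | zero =>
      have : Term.func ArithFunc.zero ts = tZero := by
        rw [tZero, Subsingleton.elim ts ![] ]
      rw [this, subst_tZero]
      exact eqRefl _
    | succ =>
      have : Term.func ArithFunc.succ ts = tSucc (ts 0) := by
        rw [tSucc]
        congr 1
        funext i
        fin_cases i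
        rfl
      rw [this, subst_tSucc, realize_tSucc]
      exact (ih 0).eq_succ
    | add =>
      have : Term.func ArithFunc.add ts = tAdd (ts 0) (ts 1) := by
        rw [tAdd]
        congr 1
        funext i
        fin_cases i <;> rfl
      rw [this, subst_tAdd, realize_tAdd]
      exact ((ih 0).eq_add (ih 1)).eq_trans (numeral_add _ _)
    | mul =>
      have : Term.func ArithFunc.mul ts = tMul (ts 0) (ts 1) := by
        rw [tMul]
        congr 1
        funext i
        fin_cases i <;> rfl
      rw [this, subst_tMul, realize_tMul]
      exact ((ih 0).eq_mul (ih 1)).eq_trans (numeral_mul _ _)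

/-- Induction on `N` outside `PA`: the axiom for `<` splits s < N + 1 into s < N and s = N, and
Leibniz's rule settles the second case. -/
theorem of_lt_numeral {N : ℕ} {s : LA.Term (ℕ ⊕ Fin n)} {φ : LA.BoundedFormula ℕ (n + 1)}
    (h : ∀ k < N, Derives PA Γ (inst φ (numeral k))) :
    Derives PA Γ ((fLt s (numeral N)).imp (inst φ s)) := by
  induction N with
  | zero => exact imp_of_not (not_lt_zero _)
  | succ N ih =>
    refine impI (orE (.impE (lt_succ _ _).iffE_left head) ?_ ?_)
    · exact .impE (ih fun k hk => h k (by omega)).insert.insert head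
    · exact eqSubst φ head.eq_symm (h N (by omega)).insert.insert

end Arithmetic

end Derives

/-! ### `Σ₁`-completeness of Peano arithmetic -/

section Completeness

variable {α : Type}

/-- The substitution of numerals for the values of the variables. -/
def numeralSubst {n m : ℕ} (v : α → ℕ) (xs : Fin n → ℕ) :
    α ⊕ Fin n → LA.Term (ℕ ⊕ Fin m) := fun x => numeral (Sum.elim v xs x)

theorem weaken_numeralSubst {n m : ℕ} (v : α → ℕ) (xs : Fin n → ℕ)
    (φ : LA.BoundedFormula α n) :
    weaken (fSubst (numeralSubst v xs : _ → LA.Term (ℕ ⊕ Fin m)) φ) =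
      fSubst (numeralSubst v xs) φ := by
  rw [weaken_fSubst]
  congr 1
  funext x
  exact tLift_numeral _

theorem inst_numeralSubst {n m : ℕ} (v : α → ℕ) (xs : Fin n → ℕ) (k : ℕ)
    (φ : LA.BoundedFormula α (n + 1)) :
    inst (fSubst (liftSubst (numeralSubst v xs : _ → LA.Term (ℕ ⊕ Fin m))) φ) (numeral k) =
      fSubst (numeralSubst v (Fin.snoc xs k)) φ := by
  rw [inst_fSubst_liftSubst]
  congr 1
  funext x
  rcases x with a | i
  · rfl
  · refine Fin.lastCases ?_ (fun i => ?_) i <;> simp [numeralSubst]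

/-- Presents the open body of a quantifier as an instance at the eigenvariable, the form in which
`Derives.of_lt_numeral` applies to it. -/
theorem inst_numeralSubst_bvar {n m : ℕ} (v : α → ℕ) (xs : Fin n → ℕ)
    (φ : LA.BoundedFormula α (n + 1)) :
    inst (fSubst (liftSubst (numeralSubst v xs : _ → LA.Term (ℕ ⊕ Fin (m + 1)))) φ)
        (bvar (Fin.last m)) =
      fSubst (liftSubst (numeralSubst v xs : _ → LA.Term (ℕ ⊕ Fin m))) φ := by
  rw [inst_fSubst_liftSubst]
  congr 1
  funext x
  rcases x with a | i
  · exact (tLift_numeral _).symm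
  · refine Fin.lastCases ?_ (fun i => ?_) i
    · simp
    · simp only [liftSubst, Sum.elim_inr, Fin.snoc_castSucc]
      exact (tLift_numeral _).symm

/-- The instances are derived in the empty context, while the premise of ∀-introduction lives in a
context with one variable. They are therefore cut in as assumptions before the quantifier is
introduced; being closed by numerals, they survive the weakening unchanged. The formula `χ` leaves
room for the double negation that arises when a bounded ∃ is refuted. -/
theorem derives_all_of_ball {n : ℕ} {v : α → ℕ} {xs : Fin n → ℕ}
    (t : LA.Term (α ⊕ Fin n)) {φ : LA.BoundedFormula α (n + 1)}
    (h : ∀ k < t.realize (Sum.elim v xs), Derives PA ∅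
      (fSubst (numeralSubst v (Fin.snoc xs k) : _ → LA.Term (ℕ ⊕ Fin 0)) φ))
    {χ : LA.BoundedFormula ℕ 1}
    (hχ : ∀ Γ, Derives PA Γ ((fLt (bvar (Fin.last 0)) (tLift (t.subst (numeralSubst v xs)))).imp
      (fSubst (liftSubst (numeralSubst v xs)) φ)) → Derives PA Γ χ) :
    Derives PA ∅ χ.all := by
  refine Derives.cut_of_forall_lt h (.allI (hχ _ (.impI ?_)))
  rw [← inst_numeralSubst_bvar]
  refine .impE (Derives.of_lt_numeral (N := t.realize (Sum.elim v xs)) fun k hk => .hyp ?_)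
    (Derives.lt_congr (.eqRefl _) ?_ Derives.head)
  · rw [inst_numeralSubst]
    refine Or.inr ⟨_, Or.inr ⟨k, hk, rfl⟩, ?_⟩
    exact weaken_numeralSubst _ _ _
  · rw [tLift_eq_subst, term_subst_subst]
    simpa [numeralSubst] using Derives.term_eval (Sum.elim v xs) t

/-- Since ∃ is ¬∀¬, this treats existential witnesses as well as counterexamples to ∀. -/
theorem derives_numeralSubst_not_all {n : ℕ} {v : α → ℕ} {xs : Fin n → ℕ}
    {φ : LA.BoundedFormula α (n + 1)} (k : ℕ)
    (h : Derives PA ∅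
      (fSubst (numeralSubst v (Fin.snoc xs k) : _ → LA.Term (ℕ ⊕ Fin 0)) φ).not) :
    Derives PA ∅ (fSubst (numeralSubst v xs : _ → LA.Term (ℕ ⊕ Fin 0)) φ.all).not := by
  refine Derives.not_all (t := numeral k) ?_
  rwa [inst_numeralSubst]

theorem derives_numeralSubst_lt {n : ℕ} {v : α → ℕ} {xs : Fin n → ℕ}
    {s t : LA.Term (α ⊕ Fin n)}
    (h : s.realize (Sum.elim v xs) < t.realize (Sum.elim v xs)) :
    Derives PA ∅ (fSubst (numeralSubst v xs : _ → LA.Term (ℕ ⊕ Fin 0)) (fLt s t)) := by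
  rw [fSubst_fLt]
  exact Derives.lt_congr (Derives.term_eval _ s).eq_symm (Derives.term_eval _ t).eq_symm
    (Derives.numeral_lt h)

/-- Peano arithmetic decides the `Δ₀` sentences correctly. -/
theorem IsDelta0.derives {n : ℕ} {φ : LA.BoundedFormula α n} (h : IsDelta0 φ) (v : α → ℕ)
    (xs : Fin n → ℕ) :
    (φ.Realize v xs →
      Derives PA ∅ (fSubst (numeralSubst v xs : _ → LA.Term (ℕ ⊕ Fin 0)) φ)) ∧
    (¬ φ.Realize v xs →
      Derives PA ∅ (fSubst (numeralSubst v xs : _ → LA.Term (ℕ ⊕ Fin 0)) φ).not) := by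
  induction h with
  | falsum => exact ⟨fun h => h.elim, fun _ => .impI Derives.head⟩
  | equal s t =>
    constructor
    · intro h
      have hs := Derives.term_eval (Γ := (∅ : Set (LA.BoundedFormula ℕ 0))) (Sum.elim v xs) s
      rw [(realize_equal v xs s t).mp h] at hs
      exact hs.eq_trans (Derives.term_eval _ t).eq_symm
    · intro h
      refine .notI (.impE (Derives.numeral_ne h) ?_)
      exact (Derives.term_eval _ s).eq_symm.eq_trans
        (Derives.head.eq_trans (Derives.term_eval _ t))
  | rel R ts =>
    cases R
    have hts : (BoundedFormula.rel ArithRel.lt ts) = fLt (ts 0) (ts 1) := by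
      rw [fLt]
      congr 1
      funext i
      fin_cases i <;> rfl
    change ((BoundedFormula.rel ArithRel.lt ts).Realize v xs → _) ∧
      (¬ (BoundedFormula.rel ArithRel.lt ts).Realize v xs → _)
    rw [hts]
    refine ⟨derives_numeralSubst_lt, fun h => ?_⟩
    rw [fSubst_fLt]
    refine .notI (.impE (Derives.numeral_not_lt h) ?_)
    exact Derives.lt_congr (Derives.term_eval _ (ts 0)) (Derives.term_eval _ (ts 1)) Derives.head
  | @imp n φ ψ _ _ ih₁ ih₂ =>
    rw [BoundedFormula.realize_imp]
    constructor
    · intro h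
      by_cases hφ : φ.Realize v xs
      · exact ((ih₂ xs).1 (h hφ)).imp_of_right
      · exact ((ih₁ xs).2 hφ).imp_of_not
    · intro h
      rw [Classical.not_imp] at h
      exact .not_imp ((ih₁ xs).1 h.1) ((ih₂ xs).2 h.2)
  | @ball n t φ _ ih =>
    rw [realize_fBall]
    constructor
    · intro h
      rw [fSubst_fBall]
      exact derives_all_of_ball t (fun k hk => (ih _).1 (h k hk)) fun _ h => h
    · intro h
      push Not at h
      obtain ⟨k, hk, h⟩ := h
      refine derives_numeralSubst_not_all k (.not_imp ?_ ((ih _).2 h))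
      exact derives_numeralSubst_lt (by simpa using hk)
  | @bex n t φ _ ih =>
    rw [realize_fBex]
    constructor
    · rintro ⟨k, hk, h⟩
      refine derives_numeralSubst_not_all k (.not_not (.andI ?_ ((ih _).1 h)))
      exact derives_numeralSubst_lt (by simpa using hk)
    · intro h
      push Not at h
      -- The negated bounded ∃ unfolds to ¬¬∀x ¬¬(x < t → ¬φ).
      rw [fSubst_fBex]
      exact .not_not (derives_all_of_ball (φ := φ.not) t (fun k hk => (ih _).2 (h k hk))
        fun _ h => h.not_not)

/-- Peano arithmetic proves the true `Σ₁` sentences and refutes the false `Π₁` sentences. -/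
theorem IsHier.derives {p : Side} {n : ℕ} {φ : LA.BoundedFormula α n} (h : IsHier p φ)
    (v : α → ℕ) (xs : Fin n → ℕ) :
    (p = .sigma → φ.Realize v xs →
      Derives PA ∅ (fSubst (numeralSubst v xs : _ → LA.Term (ℕ ⊕ Fin 0)) φ)) ∧
    (p = .pi → ¬ φ.Realize v xs →
      Derives PA ∅ (fSubst (numeralSubst v xs : _ → LA.Term (ℕ ⊕ Fin 0)) φ).not) := by
  -- Negation and the antecedent of an implication exchange Σ₁ and Π₁, so the two halves must be
  -- proved together.
  induction h with
  | delta0 h => exact ⟨fun _ => (h.derives v xs).1, fun _ => (h.derives v xs).2⟩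
  | and _ _ ih₁ ih₂ =>
    rw [BoundedFormula.realize_inf]
    refine ⟨fun hp h => .andI ((ih₁ xs).1 hp h.1) ((ih₂ xs).1 hp h.2), fun hp h => ?_⟩
    rcases not_and_or.mp h with h | h
    · exact .not_and_left ((ih₁ xs).2 hp h)
    · exact .not_and_right ((ih₂ xs).2 hp h)
  | or _ _ ih₁ ih₂ =>
    rw [BoundedFormula.realize_sup]
    refine ⟨fun hp h => ?_, fun hp h => ?_⟩
    · rcases h with h | h
      · exact .orI_left ((ih₁ xs).1 hp h)
      · exact .orI_right ((ih₂ xs).1 hp h)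
    · rw [not_or] at h
      exact .not_or ((ih₁ xs).2 hp h.1) ((ih₂ xs).2 hp h.2)
  | ex _ ih =>
    rw [BoundedFormula.realize_ex]
    refine ⟨fun _ ⟨k, h⟩ => derives_numeralSubst_not_all k (.not_not ((ih _).1 rfl h)),
      (nomatch ·)⟩
  | all _ ih =>
    rw [BoundedFormula.realize_all]
    refine ⟨(nomatch ·), fun _ h => ?_⟩
    obtain ⟨k, h⟩ := not_forall.mp h
    exact derives_numeralSubst_not_all k ((ih _).2 rfl h)
  | @not p n φ _ ih =>
    rw [BoundedFormula.realize_not]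
    refine ⟨fun hp h => (ih xs).2 (by rw [hp]; rfl) h,
      fun hp h => .not_not ((ih xs).1 (by rw [hp]; rfl) (Classical.not_not.mp h))⟩
  | @imp p n φ ψ _ _ ih₁ ih₂ =>
    rw [BoundedFormula.realize_imp]
    refine ⟨fun hp h => ?_, fun hp h => ?_⟩
    · by_cases hφ : φ.Realize v xs
      · exact ((ih₂ xs).1 hp (h hφ)).imp_of_right
      · exact ((ih₁ xs).2 (by rw [hp]; rfl) hφ).imp_of_not
    · rw [Classical.not_imp] at h
      exact .not_imp ((ih₁ xs).1 (by rw [hp]; rfl) h.1) ((ih₂ xs).2 hp h.2)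

/-- Every true `Σ₁` sentence is a theorem of Peano arithmetic. -/
theorem provableSentence_PA_of_isSigma1 {σ : LA.Sentence} (h : IsSigma1 σ) (hσ : ℕ ⊨ σ) :
    ProvableSentence PA σ := by
  have := (IsHier.derives h Empty.elim Fin.elim0).1 rfl ((sentence_realize_iff _ _ _).mp hσ)
  rw [ProvableSentence, Provable, ofSentence]
  convert this using 2
  funext x
  rcases x with a | i
  · exact a.elim
  · exact i.elim0

end Completeness

/-! ### Functions with a `Σ₁` graph -/

section SigmaFunctions

/-- The formula saying that `z` is the value of the pairing function at `x` and `y`. -/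
def fPair {n : ℕ} (x y z : LA.Term (Empty ⊕ Fin n)) : LA.BoundedFormula Empty n :=
  (fLt x y ⊓ .equal z (tAdd (tMul y y) x)) ⊔
    ((fLt x y).not ⊓ .equal z (tAdd (tAdd (tMul x x) x) y))

/-- The formula saying that `z` is the remainder of `a` modulo `(i + 1) * b + 1`. -/
def fBeta {n : ℕ} (a b i z : LA.Term (Empty ⊕ Fin n)) : LA.BoundedFormula Empty n :=
  fLt z (tSucc (tMul (tSucc i) b)) ⊓
    fBex (tSucc a) (.equal (tLift a)
      (tAdd (tMul (bvar (Fin.last n)) (tLift (tSucc (tMul (tSucc i) b)))) (tLift z)))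

variable {n : ℕ} {v : Empty → ℕ} {xs : Fin n → ℕ}

theorem IsDelta0.not {φ : LA.BoundedFormula Empty n} (h : IsDelta0 φ) : IsDelta0 φ.not :=
  .imp h .falsum

theorem IsDelta0.and {φ ψ : LA.BoundedFormula Empty n} (h₁ : IsDelta0 φ) (h₂ : IsDelta0 ψ) :
    IsDelta0 (φ ⊓ ψ) :=
  (IsDelta0.imp h₁ h₂.not).not

theorem IsDelta0.or {φ ψ : LA.BoundedFormula Empty n} (h₁ : IsDelta0 φ) (h₂ : IsDelta0 ψ) :
    IsDelta0 (φ ⊔ ψ) :=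
  .imp h₁.not h₂

theorem isDelta0_fLt (s t : LA.Term (Empty ⊕ Fin n)) : IsDelta0 (fLt s t) := .rel _ _

theorem isDelta0_fPair (x y z : LA.Term (Empty ⊕ Fin n)) : IsDelta0 (fPair x y z) :=
  ((isDelta0_fLt _ _).and (.equal _ _)).or ((isDelta0_fLt _ _).not.and (.equal _ _))

theorem isDelta0_fBeta (a b i z : LA.Term (Empty ⊕ Fin n)) : IsDelta0 (fBeta a b i z) :=
  (isDelta0_fLt _ _).and (.bex _ (.equal _ _))

theorem realize_fPair (x y z : LA.Term (Empty ⊕ Fin n)) :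
    (fPair x y z).Realize v xs ↔ z.realize (Sum.elim v xs) =
      Nat.pair (x.realize (Sum.elim v xs)) (y.realize (Sum.elim v xs)) := by
  simp only [fPair, BoundedFormula.realize_sup, BoundedFormula.realize_inf,
    BoundedFormula.realize_not, realize_fLt, realize_equal, realize_tAdd, realize_tMul, Nat.pair]
  split_ifs with h <;> simp [h]

/-- The quotient is at most `a`, so the remainder relation needs only a bounded quantifier. -/
theorem eq_mod_iff (a M z : ℕ) (hM : 0 < M) :
    z < M ∧ (∃ q < a + 1, a = q * M + z) ↔ z = a % M := by
  constructor
  · rintro ⟨hz, q, -, rfl⟩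
    rw [Nat.mul_add_mod_self_right, Nat.mod_eq_of_lt hz]
  · rintro rfl
    refine ⟨Nat.mod_lt _ hM, a / M, Nat.lt_succ_of_le (Nat.div_le_self _ _), ?_⟩
    rw [Nat.mul_comm, Nat.div_add_mod]

theorem realize_fBeta (a b i z : LA.Term (Empty ⊕ Fin n)) :
    (fBeta a b i z).Realize v xs ↔ z.realize (Sum.elim v xs) =
      a.realize (Sum.elim v xs) %
        ((i.realize (Sum.elim v xs) + 1) * b.realize (Sum.elim v xs) + 1) := by
  rw [← eq_mod_iff _ _ _ (Nat.succ_pos _)]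
  simp [fBeta]

/-- Gödel's β-function lemma, with the code of the sequence split into its two components. -/
theorem exists_beta (g : ℕ → ℕ) (x : ℕ) :
    ∃ a b : ℕ, ∀ i ≤ x, a % ((i + 1) * b + 1) = g i := by
  refine ⟨(Nat.unbeta ((List.range (x + 1)).map g)).unpair.1,
    (Nat.unbeta ((List.range (x + 1)).map g)).unpair.2, fun i hi => ?_⟩
  have := Nat.beta_unbeta_coe ((List.range (x + 1)).map g) ⟨i, by simpa using by omega⟩
  simpa [Nat.beta] using this

/-- The formula `φ(s, t)`. -/
def fApply (φ : LA.BoundedFormula Empty 2) (s t : LA.Term (Empty ⊕ Fin n)) :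
    LA.BoundedFormula Empty n :=
  fSubst (Sum.elim Empty.elim ![s, t]) φ

theorem realize_fApply (φ : LA.BoundedFormula Empty 2) (s t : LA.Term (Empty ⊕ Fin n)) :
    (fApply φ s t).Realize v xs ↔
      φ.Realize v ![s.realize (Sum.elim v xs), t.realize (Sum.elim v xs)] := by
  rw [fApply, realize_fSubst]
  apply iff_of_eq
  congr 1
  · exact Subsingleton.elim _ _
  · funext i
    fin_cases i <;> rfl

/-- The graph of `g` is defined by a `Σ₁` formula in the standard model. -/
def IsSigmaFun (g : ℕ → ℕ) : Prop :=
  ∃ φ : LA.BoundedFormula Empty 2, IsSigma1 φ ∧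
    ∀ (v : Empty → ℕ) (x y : ℕ), φ.Realize v ![x, y] ↔ y = g x

namespace IsSigmaFun

variable {g h : ℕ → ℕ}

theorem const (k : ℕ) : IsSigmaFun fun _ => k :=
  ⟨.equal (bvar 1) (numeral k), .delta0 (.equal _ _), fun v x y => by simp⟩

theorem id : IsSigmaFun fun n => n :=
  ⟨.equal (bvar 1) (bvar 0), .delta0 (.equal _ _), fun v x y => by simp⟩

theorem succ (hg : IsSigmaFun g) : IsSigmaFun fun n => g n + 1 := by
  obtain ⟨φ, hφ, hr⟩ := hg
  refine ⟨(fApply φ (bvar 0) (bvar 2) ⊓ .equal (bvar 1) (tSucc (bvar 2))).ex,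
    .ex (.and (hφ.subst _) (.delta0 (.equal _ _))), fun v x y => ?_⟩
  simp [realize_fApply, hr]

theorem pair (hg : IsSigmaFun g) (hh : IsSigmaFun h) :
    IsSigmaFun fun n => Nat.pair (g n) (h n) := by
  obtain ⟨φ, hφ, hr⟩ := hg
  obtain ⟨ψ, hψ, hs⟩ := hh
  refine ⟨(fApply φ (bvar 0) (bvar 2) ⊓ (fApply ψ (bvar 0) (bvar 3) ⊓
      fPair (bvar 2) (bvar 3) (bvar 1))).ex.ex,
    .ex (.ex (.and (hφ.subst _) (.and (hψ.subst _) (.delta0 (isDelta0_fPair _ _ _))))),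
    fun v x y => ?_⟩
  simp [realize_fApply, realize_fPair, hr, hs]

/-- The values up to the argument are coded by β. Each of them is a remainder of a, hence at most a,
which bounds the quantifiers of the recursion step; only a and b are quantified without bound. -/
theorem rec_pair {k l : ℕ} (h₀ : g 0 = k) (h₁ : ∀ n, g (n + 1) = Nat.pair l (g n) + 1) :
    IsSigmaFun g := by
  -- Variables: 0 is the argument x, 1 the value y, 2 and 3 the β-code a, b, 4 the index i, 5 and 6
  -- the consecutive values u, w, and 7 the pair p, which is less than w = p + 1.
  refine ⟨(fBeta (bvar 2) (bvar 3) tZero (numeral k) ⊓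
      (fBall (bvar 0) (fBex (tSucc (bvar 2)) (fBex (tSucc (bvar 2)) (fBex (bvar 6)
        (fBeta (bvar 2) (bvar 3) (bvar 4) (bvar 5) ⊓
          (fBeta (bvar 2) (bvar 3) (tSucc (bvar 4)) (bvar 6) ⊓
            (fPair (numeral l) (bvar 5) (bvar 7) ⊓ .equal (bvar 6) (tSucc (bvar 7)))))))) ⊓
        fBeta (bvar 2) (bvar 3) (bvar 0) (bvar 1))).ex.ex, ?_, fun v x y => ?_⟩
  · refine .ex (.ex (.and (.delta0 (isDelta0_fBeta _ _ _ _)) (.and (.delta0 ?_)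
      (.delta0 (isDelta0_fBeta _ _ _ _)))))
    exact .ball _ (.bex _ (.bex _ (.bex _ ((isDelta0_fBeta _ _ _ _).and
      ((isDelta0_fBeta _ _ _ _).and ((isDelta0_fPair _ _ _).and (.equal _ _)))))))
  · simp only [BoundedFormula.realize_ex, BoundedFormula.realize_inf, realize_fBall,
      realize_fBex, realize_fBeta, realize_fPair, realize_equal, realize_bvar, realize_tSucc,
      realize_numeral, realize_tZero]
    change (∃ a b : ℕ, k = a % ((0 + 1) * b + 1) ∧ (∀ i < x, ∃ u < a + 1, ∃ w < a + 1, ∃ p < w,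
      u = a % ((i + 1) * b + 1) ∧ w = a % ((i + 1 + 1) * b + 1) ∧ p = Nat.pair l u ∧ w = p + 1) ∧
      y = a % ((x + 1) * b + 1)) ↔ y = g x
    constructor
    · rintro ⟨a, b, hk, hstep, rfl⟩
      have : ∀ i ≤ x, a % ((i + 1) * b + 1) = g i := by
        intro i
        induction i with
        | zero => exact fun _ => by rw [← hk, h₀]
        | succ i ih =>
          intro hi
          obtain ⟨u, -, w, -, p, -, hu, hw, hp, hwp⟩ := hstep i (by omega)
          rw [← hw, hwp, hp, hu, ih (by omega), h₁]
      exact this x le_rfl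
    · rintro rfl
      obtain ⟨a, b, hab⟩ := exists_beta g x
      have hle : ∀ i ≤ x, g i < a + 1 := fun i hi => by
        rw [← hab i hi]
        exact Nat.lt_succ_of_le (Nat.mod_le _ _)
      refine ⟨a, b, ?_, fun i hi => ⟨g i, hle i hi.le, g (i + 1), hle _ hi, Nat.pair l (g i), ?_,
        (hab i hi.le).symm, (hab _ hi).symm, rfl, h₁ i⟩, (hab x le_rfl).symm⟩
      · rw [← h₀, hab 0 (Nat.zero_le _)]
      · rw [h₁]
        exact Nat.lt_succ_self _

theorem termCode_numeral {m : ℕ} :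
    IsSigmaFun fun k => termCode (numeral k : LA.Term (ℕ ⊕ Fin m)) :=
  -- 3 is the tag of the successor in `termCode`.
  rec_pair (l := 3) rfl fun _ => rfl

end IsSigmaFun

end SigmaFunctions

/-! ### The diagonal sentence -/

section Diagonal

/-- For every `Σ₁` predicate `PR(x)`, there is a sentence that is true in the standard model if
and only if `PR(x)` is false of its Gödel number, and whose negation is `Σ₁`. -/
theorem exists_diagonal {PR : LA.Formula (Fin 1)} (hPR : IsSigma1 PR) :
    ∃ σ : LA.Sentence, IsSigma1 σ.not ∧ (ℕ ⊨ σ ↔ ¬ ℕ ⊨ applyNumeral PR (sentenceCode σ)) := by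
  -- If e is the code of ψ(x), this is the code of ∀x (x = e → ψ(x)); 10, 9 and 7 are the tags of ∀,
  -- → and =. The equation replaces a substitution of the numeral for x, so no substitution function
  -- has to be arithmetized.
  have hs : IsSigmaFun fun e => Nat.pair 10 (Nat.pair 9 (Nat.pair (Nat.pair 7 (Nat.pair
      (termCode (bvar 0 : LA.Term (ℕ ⊕ Fin 1)))
      (termCode (numeral e : LA.Term (ℕ ⊕ Fin 1)))) + 1) e) + 1) + 1 :=
    ((IsSigmaFun.const 10).pair (((IsSigmaFun.const 9).pair ((((IsSigmaFun.const 7).pair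
      ((IsSigmaFun.const _).pair IsSigmaFun.termCode_numeral)).succ).pair .id)).succ)).succ
  obtain ⟨φ, hφ, hr⟩ := hs
  -- θ(x) says that `PR` holds of the value at x of the function in `hs`.
  let θ : LA.BoundedFormula Empty 1 :=
    (φ ⊓ fSubst (Sum.elim (fun _ => bvar 1) Fin.elim0) PR).ex
  have hθ : IsSigma1 θ := .ex (.and hφ (hPR.subst _))
  obtain ⟨e, he⟩ : ∃ e, e = formulaCode (fSubst (liftSubst (Sum.elim Empty.elim Fin.elim0))
    θ.not : LA.BoundedFormula ℕ 1) := ⟨_, rfl⟩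
  obtain ⟨σ, hσ⟩ : ∃ σ : LA.Sentence,
    σ = ((BoundedFormula.equal (bvar 0) (numeral e)).imp θ.not).all := ⟨_, rfl⟩
  have hcode : sentenceCode σ = Nat.pair 10 (Nat.pair 9 (Nat.pair (Nat.pair 7 (Nat.pair
      (termCode (bvar 0 : LA.Term (ℕ ⊕ Fin 1)))
      (termCode (numeral e : LA.Term (ℕ ⊕ Fin 1)))) + 1) e) + 1) + 1 := by
    rw [hσ]
    change Nat.pair 10 (Nat.pair 9 (Nat.pair (Nat.pair 7 (Nat.pair
      (termCode ((bvar 0 : LA.Term (Empty ⊕ Fin 1)).subst _))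
      (termCode ((numeral e : LA.Term (Empty ⊕ Fin 1)).subst _))) + 1)
      (formulaCode (fSubst (liftSubst (Sum.elim Empty.elim Fin.elim0)) θ.not))) + 1) + 1 = _
    rw [subst_numeral, subst_bvar, ← he]
    rfl
  -- σ is Π₁, because θ is Σ₁.
  refine ⟨σ, hσ ▸ .not (.all (.imp (.delta0 (.equal _ _)) (.not hθ))), ?_⟩
  have hsnoc : ∀ x y : ℕ, (Fin.snoc ![x] y : Fin 2 → ℕ) = ![x, y] := fun x y => by
    funext i
    fin_cases i <;> rfl
  have hsnoc₀ : ∀ x : ℕ, (Fin.snoc Fin.elim0 x : Fin 1 → ℕ) = ![x] := fun x => by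
    funext i
    fin_cases i
    rfl
  -- By `hcode`, the value at e of the function in `hs` is the code of σ itself.
  have hθe : θ.Realize Empty.elim ![e] ↔ ℕ ⊨ applyNumeral PR (sentenceCode σ) := by
    rw [sentence_realize_iff _ Empty.elim Fin.elim0, applyNumeral, realize_fSubst]
    simp only [θ, BoundedFormula.realize_ex, BoundedFormula.realize_inf, hsnoc, hr, ← hcode,
      realize_fSubst, exists_eq_left]
    apply iff_of_eq
    congr 1
    · funext i
      simp
    · exact Subsingleton.elim _ _
  rw [← hθe, sentence_realize_iff _ Empty.elim Fin.elim0]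
  simp only [hσ, BoundedFormula.realize_all, BoundedFormula.realize_imp, realize_equal,
    BoundedFormula.realize_not, hsnoc₀, realize_bvar, realize_numeral]
  exact ⟨fun h => h e rfl, fun h x hx => by rwa [show x = e from hx]⟩

end Diagonal

/-! ### Provability logics -/

section ProvabilityLogic

variable {T : LA.Theory} {PR : LA.Formula (Fin 1)}

/-- The arithmetical interpretation based on `PR` with the values `v` at the variables. -/
def interp (PR : LA.Formula (Fin 1)) (v : ℕ → LA.Sentence) : MF → LA.Sentence
  | .var p => v p
  | .bot => .equal (numeral 0) (numeral 1)
  | .neg A => (interp PR v A).not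
  | .and A B => interp PR v A ⊓ interp PR v B
  | .or A B => interp PR v A ⊔ interp PR v B
  | .imp A B => (interp PR v A).imp (interp PR v B)
  | .box A => applyNumeral PR (sentenceCode (interp PR v A))

theorem isArithInterp_interp (PR : LA.Formula (Fin 1)) (v : ℕ → LA.Sentence) :
    IsArithInterp PR (interp PR v) where
  bot := rfl
  neg _ := rfl
  and _ _ := rfl
  or _ _ := rfl
  imp _ _ := rfl
  box _ := rfl

theorem isSigma1_applyNumeral (hPR : IsSigma1 PR) (k : ℕ) : IsSigma1 (applyNumeral PR k) :=
  hPR.subst _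

/-- A `Σ₁` provability predicate defines the theorems of a `Σ₁`-sound theory. -/
theorem provableSentence_iff_realize (hext : ExtendsPA T) (hsound : Sigma1Sound T)
    (hPRσ : IsSigma1 PR) (hPR : IsProvabilityPredicate T PR) (σ : LA.Sentence) :
    ProvableSentence T σ ↔ ℕ ⊨ applyNumeral PR (sentenceCode σ) :=
  (hPR (ofSentence σ)).trans
    ⟨fun h => hsound _ (isSigma1_applyNumeral hPRσ _) (hext _ h),
      provableSentence_PA_of_isSigma1 (isSigma1_applyNumeral hPRσ _)⟩

/-- A consistent `Σ₁`-sound extension of Peano arithmetic with a `Σ₁` provability predicate is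
incomplete. -/
theorem exists_undecidable (hcons : Consistent T) (hext : ExtendsPA T)
    (hsound : Sigma1Sound T) (hPRσ : IsSigma1 PR) (hPR : IsProvabilityPredicate T PR) :
    ∃ σ : LA.Sentence, ¬ ProvableSentence T σ ∧ ¬ ProvableSentence T σ.not := by
  obtain ⟨σ, hσ, hiff⟩ := exists_diagonal hPRσ
  have hnot : ℕ ⊨ σ.not ↔ ¬ ℕ ⊨ σ := Iff.rfl
  rw [← provableSentence_iff_realize hext hsound hPRσ hPR] at hiff
  -- Now σ is true iff `T` does not prove it. If `T ⊢ σ`, then ¬σ is a true Σ₁ sentence, hence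
  -- provable; if `T ⊢ ¬σ`, then soundness makes σ false, hence provable. Both contradict
  -- consistency.
  refine ⟨σ, fun h => ?_, fun h => ?_⟩
  · have hn : ProvableSentence T σ.not :=
      hext _ (provableSentence_PA_of_isSigma1 hσ (hnot.mpr fun hr => hiff.mp hr h))
    exact hcons (.impE hn h)
  · have hn := hnot.mp (hsound _ hσ h)
    rw [hiff, Classical.not_not] at hn
    exact hcons (.impE h hn)

/-- A true outermost box says that its content is provable. As long as that content is again a box,
it is Σ₁ and hence true by soundness. Nothing is asked of the complexity of `f A`. -/
theorem provableSentence_of_realize_boxes (hext : ExtendsPA T) (hsound : Sigma1Sound T)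
    (hPRσ : IsSigma1 PR) (hPR : IsProvabilityPredicate T PR) {f : MF → LA.Sentence}
    (hf : IsArithInterp PR f) {A : MF} (m : ℕ) (h : ℕ ⊨ f (A.boxes (m + 1))) :
    ProvableSentence T (f A) := by
  induction m with
  | zero =>
    rw [MF.boxes, hf.box] at h
    exact (provableSentence_iff_realize hext hsound hPRσ hPR _).mpr h
  | succ m ih =>
    rw [MF.boxes, hf.box] at h
    refine ih (hsound _ ?_ ((provableSentence_iff_realize hext hsound hPRσ hPR _).mpr h))
    rw [MF.boxes, hf.box]
    exact isSigma1_applyNumeral hPRσ _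

theorem imp_boxes_notMem_PL (hcons : Consistent T) (hext : ExtendsPA T)
    (hsound : Sigma1Sound T) {m : ℕ} (hm : 1 ≤ m) (hPRσ : IsSigma1 PR)
    (hPR : IsProvabilityPredicate T PR) (p : ℕ) :
    .imp (.var p) (MF.boxes m (.var p)) ∉ PL T PR := by
  obtain ⟨m, rfl⟩ := Nat.exists_eq_add_of_le' hm
  intro hmem
  obtain ⟨σ, hσ, hnσ⟩ := exists_undecidable hcons hext hsound hPRσ hPR
  let box (τ : LA.Sentence) : LA.Sentence :=
    interp PR (fun _ => τ) (MF.boxes (m + 1) (.var p))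
  have himp (τ : LA.Sentence) : ProvableSentence T (τ.imp (box τ)) :=
    hmem _ (isArithInterp_interp PR fun _ => τ)
  -- This is where m ≥ 1 enters: the outermost symbol is a box, so the complexity of τ does not
  -- matter.
  have hbox (τ : LA.Sentence) : IsSigma1 (box τ) := isSigma1_applyNumeral hPRσ _
  have hτ (τ : LA.Sentence) (h : ℕ ⊨ box τ) : ProvableSentence T τ :=
    provableSentence_of_realize_boxes hext hsound hPRσ hPR
      (isArithInterp_interp PR fun _ => τ) (A := .var p) m h
  have hor : ProvableSentence T (box σ ⊔ box σ.not) := by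
    -- The disjunction unfolds to ¬`box σ` → `box σ.not`. From ¬`box σ` the first instance gives ¬σ,
    -- and the second then gives `box σ.not`.
    refine .impI (.impE (Derives.insert (himp σ.not)) (.notI ?_))
    exact .impE Derives.head.insert (.impE (Derives.insert (Derives.insert (himp σ))) Derives.head)
  have hreal := hsound _ (.or (hbox σ) (hbox σ.not)) hor
  rw [sentence_realize_iff _ Empty.elim Fin.elim0, BoundedFormula.realize_sup,
    ← sentence_realize_iff, ← sentence_realize_iff] at hreal
  exact hreal.elim (fun h => hσ (hτ _ h)) fun h => hnσ (hτ _ h)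

end ProvabilityLogic

end ProvLogic

theorem proposition3p5 (T : ProvLogic.LA.Theory)
    (hprim : ProvLogic.PrimrecAxiomatized T)
    (hcons : ProvLogic.Consistent T)
    (hext : ProvLogic.ExtendsPA T)
    (hsound : ProvLogic.Sigma1Sound T)
    (m : ℕ) (hm : 1 ≤ m) :
    (∀ p : ℕ, ¬ ∃ PR : ProvLogic.LA.Formula (Fin 1),
      ProvLogic.IsSigma1 PR ∧ ProvLogic.IsProvabilityPredicate T PR ∧
        ProvLogic.MF.imp (.var p) (ProvLogic.MF.boxes m (.var p)) ∈ ProvLogic.PL T PR) ∧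
    (¬ ∃ PR : ProvLogic.LA.Formula (Fin 1),
      ProvLogic.IsSigma1 PR ∧ ProvLogic.IsProvabilityPredicate T PR ∧
        ProvLogic.PL T PR = ProvLogic.NPlusA m 0) := by
  refine ⟨fun p ⟨PR, hPRσ, hPR, h⟩ =>
    ProvLogic.imp_boxes_notMem_PL hcons hext hsound hm hPRσ hPR p h, fun ⟨PR, hPRσ, hPR, h⟩ => ?_⟩
  refine ProvLogic.imp_boxes_notMem_PL hcons hext hsound hm hPRσ hPR 0 ?_
  rw [h]
  -- □⁰p is p by definition.
  exact ProvLogic.NPlusADerives.acc (.var 0)
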